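/- Let $A$ be a self-adjoint, possibly unbounded operator on a complex Hilbert space $\mathcal H$, with inner product linear in the first argument. For each $n$ let $\mathcal L_n\subset\mathrm{Dom}(A)$ be an $n$-dimensional subspace (not necessarily contained in $\mathrm{Dom}(A^2)$) with an orthonormal basis $e_1,\dots,e_n$ (depending on $n$), let $\Pi_n u=\sum_{k=1}^n\langle u,e_k\rangle e_k$, and define matrices $A^{(n)}_p\in\mathbb C^{n\times n}$ by $$[A^{(n)}_0]_{jk}=\langle Ae_j,Ae_k\rangle,\qquad [A^{(n)}_1]_{jk}=\langle Ae_j,e_k\rangle,\qquad [A^{(n)}_2]_{jk}=\langle e_j,e_k\rangle .$$ Let $\lambda\in\mathrm{Spec}_{\mathrm{disc}}(A)$, i.e. $\lambda$ is an isolated point of the spectrum and an eigenvalue of finite multiplicity, and let $d=\mathrm{dist}[\lambda,\mathrm{Spec}(A)\setminus\{\lambda\}]$. Suppose that the following hypothesis holds: $$(\mathrm H)\qquad \Big\|\sum_{j=1}^n\langle A^p\Pi_n u,A^q e_j\rangle e_j-\lambda^{p+q}u\Big\|\to0\quad (n\to\infty)\qquad\text{for all } p,q\in\{0,1\}\text{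 and all }u\in\mathrm{Dom}(A)\text{ with }Au=\lambda u .$$ Then for every $\delta$ with $0<\delta<d/4$ there are $N>0$ and $\varepsilon_0,\varepsilon_1,\varepsilon_2>0$ such that, for all $n>N$ and all matrices $\tilde A_0,\tilde A_1,\tilde A_2\in\mathbb C^{n\times n}$ with $\|\tilde A_p-A^{(n)}_p\|<\varepsilon_p$ for $p=0,1,2$ (operator norm on Euclidean $\mathbb C^n$): (a) there is $\zeta\in\mathbb C$ with $\det[\tilde A_0-2\zeta\tilde A_1+\zeta^2\tilde A_2]=0$ and $|\zeta-\lambda|<\delta$; (b) the set $\{\mu\in\mathbb C:\det[\tilde A_0-2\mu\tilde A_1+\mu^2\tilde A_2]=0\}$ does not intersect the annulus $\{w\in\mathbb C:\delta<|w-\lambda|\le d/4\}$. -/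

import Mathlib

open Filter Topology

noncomputable section

namespace QuadraticMethod

variable {H : Type*} [NormedAddCommGroup H] [InnerProductSpace ℂ H]

/-- `z` lies in the resolvent set of the (possibly unbounded) operator `A` when `A - z`, as a map
from the domain of `A` to `H`, has an everywhere defined bounded two-sided inverse. -/
def resolventSet (A : H →ₗ.[ℂ] H) : Set ℂ :=
  {z | ∃ R : H →L[ℂ] H,
    (∀ y : H, ∃ h : R y ∈ A.domain, A ⟨R y, h⟩ - z • R y = y) ∧
    (∀ x : A.domain, R (A x - z • (x : H)) = x)}

/-- The spectrum of the operator `A`. -/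
def spec (A : H →ₗ.[ℂ] H) : Set ℂ := (resolventSet A)ᶜ

/-- The eigenspace `{u ∈ Dom(A) : A u = z u}`, as a subspace of `Dom(A)`. -/
def eigenspace (A : H →ₗ.[ℂ] H) (z : ℂ) : Submodule ℂ A.domain :=
  LinearMap.ker (A.toFun - z • A.domain.subtype)

/-- The discrete spectrum: the isolated points of the spectrum which are eigenvalues of finite
multiplicity. -/
def discreteSpec (A : H →ₗ.[ℂ] H) : Set ℂ :=
  {z | z ∈ spec A ∧ (∃ r > 0, ∀ w ∈ spec A, w ≠ z → r ≤ dist w z) ∧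
    eigenspace A z ≠ ⊥ ∧ FiniteDimensional ℂ (eigenspace A z)}

/-- `A ^ p x` for `x ∈ Dom(A)` and `p = 0, 1`. -/
def applyPow (A : H →ₗ.[ℂ] H) (p : Fin 2) (x : A.domain) : H :=
  if p = 0 then x else A x

/-- The basis vector `e j` of `L`, as an element of `Dom(A)`. -/
def basisVec {A : H →ₗ.[ℂ] H} {L : Submodule ℂ H} (hL : L ≤ A.domain) {n : ℕ}
    (e : OrthonormalBasis (Fin n) ℂ L) (j : Fin n) : A.domain :=
  Submodule.inclusion hL (e j)

/-- The orthogonal projection of `u` onto `L`, that is `∑ₖ ⟨u, eₖ⟩ eₖ`, as an element of `Dom(A)`.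
(Mathlib's inner product is linear in its second argument, so that the product `⟨x, y⟩` linear in
the first argument is `inner ℂ y x`, here and below.) -/
def proj {A : H →ₗ.[ℂ] H} {L : Submodule ℂ H} (hL : L ≤ A.domain) {n : ℕ}
    (e : OrthonormalBasis (Fin n) ℂ L) (u : H) : A.domain :=
  ∑ k, inner ℂ (e k : H) u • basisVec hL e k

/-- The approximation hypothesis on the spaces `L n` relative to `z`: for `p, q = 0, 1` and all
`u ∈ Dom(A)` with `A u = z u`, the norm of `∑ⱼ ⟨A^p Πₙ u, A^q eⱼ⟩ eⱼ - z^(p+q) u` tends to `0`. -/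
def HypothesisH (A : H →ₗ.[ℂ] H) {L : ℕ → Submodule ℂ H} (hL : ∀ n, L n ≤ A.domain)
    (e : ∀ n, OrthonormalBasis (Fin n) ℂ (L n)) (z : ℂ) : Prop :=
  ∀ p q : Fin 2, ∀ u : A.domain, A u = z • (u : H) →
    Tendsto (fun n : ℕ =>
      ‖∑ j, inner ℂ (applyPow A q (basisVec (hL n) (e n) j))
          (applyPow A p (proj (hL n) (e n) (u : H))) • (e n j : H)
        - z ^ (p.val + q.val) • (u : H)‖) atTop (𝓝 0)

/-- The coefficient matrices of the quadratic problem on `L`: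
`[A₀]ⱼₖ = ⟨A eⱼ, A eₖ⟩`, `[A₁]ⱼₖ = ⟨A eⱼ, eₖ⟩`, `[A₂]ⱼₖ = ⟨eⱼ, eₖ⟩`. -/
def coeffMatrix (A : H →ₗ.[ℂ] H) {L : Submodule ℂ H} (hL : L ≤ A.domain) {n : ℕ}
    (e : OrthonormalBasis (Fin n) ℂ L) : Fin 3 → Matrix (Fin n) (Fin n) ℂ :=
  ![Matrix.of fun j k => inner ℂ (A (basisVec hL e k)) (A (basisVec hL e j)),
    Matrix.of fun j k => inner ℂ (basisVec hL e k : H) (A (basisVec hL e j)),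
    Matrix.of fun j k => inner ℂ (basisVec hL e k : H) (basisVec hL e j : H)]

/-- The roots of the quadratic matrix problem `det [B₀ - 2 ζ B₁ + ζ² B₂] = 0`. -/
def quadraticRoots {n : ℕ} (B : Fin 3 → Matrix (Fin n) (Fin n) ℂ) : Set ℂ :=
  {ζ | (B 0 - (2 * ζ) • B 1 + ζ ^ 2 • B 2).det = 0}

/-- The operator norm of a matrix acting on `ℂⁿ` with its Euclidean norm. -/
def opNorm {n : ℕ} (B : Matrix (Fin n) (Fin n) ℂ) : ℝ :=
  ‖Matrix.toEuclideanCLM (n := Fin n) (𝕜 := ℂ) B‖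

end QuadraticMethod

end

noncomputable section

namespace QuadraticMethod

/-! ### The spectral gap of `A` around an isolated eigenvalue. -/

section Spectral

variable {H : Type*} [NormedAddCommGroup H] [InnerProductSpace ℂ H]

/-! In suitable coordinates the matrix pencil is the restriction to `L n` of the form ⟨(A - z̄)v, (A
- z)w⟩, so everything reduces to bounds on that form, uniform in `n`.

On the annulus δ/2 ≤ |z - λ| ≤ d/4 the form satisfies an inf-sup condition
(`exists_mul_norm_sq_le_norm_quadForm`). Split v into its eigenspace part p and a remainder v'. On
v' the spectral gap (`norm_le_norm_apply_sub_of_orthogonal`) makes ‖(A - λ)v'‖² dominate. The p part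
contributes (z - λ)²‖p‖², whose phase is corrected by adding a multiple of Πp to the test vector;
(H) makes this legitimate up to a small error (`eventually_norm_quadForm_proj_sub_le`). The
resulting lower bound survives small perturbations of the matrices, which gives (b).

For (a), were there no root within δ of λ, the maximum principle (`mul_norm_le_of_sphere`) would
carry the lower bound from the circle |z - λ| = δ/2 to its centre. But at z = λ the pencil is small
on the coordinates of Πu, for u an eigenvector. -/

theorem mem_eigenspace_iff {A : H →ₗ.[ℂ] H} {z : ℂ} {u : A.domain} :
    u ∈ eigenspace A z ↔ A u = z • (u : H) := by
  simp [eigenspace, LinearMap.mem_ker, sub_eq_zero]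

/-- If `t ≠ 0` and `c + t⁻¹` lies in the resolvent set of `A`, then `t` lies in the resolvent set of
the resolvent `R` of `A` at `c`. -/
theorem isUnit_resolvent_sub {A : H →ₗ.[ℂ] H} {c t : ℂ} (ht : t ≠ 0) {R : H →L[ℂ] H}
    (hR₁ : ∀ y : H, ∃ h : R y ∈ A.domain, A ⟨R y, h⟩ - c • R y = y)
    (hR₂ : ∀ x : A.domain, R (A x - c • (x : H)) = x)
    (hct : c + t⁻¹ ∈ resolventSet A) :
    IsUnit (algebraMap ℂ (H →L[ℂ] H) t - R) := by
  obtain ⟨S, hS₁, hS₂⟩ := hct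
  have hRS : ∀ y, R (S y) = t • S y - t • R y := by
    intro y
    obtain ⟨h, hy⟩ := hS₁ y
    have h2 := hR₂ ⟨S y, h⟩
    have h3 : A ⟨S y, h⟩ - c • S y = y + t⁻¹ • S y := by
      nth_rw 3 [← hy]; module
    simp only [h3, map_add, map_smul] at h2
    have h4 : t • R y + R (S y) = t • S y := by
      nth_rw 2 [← h2]
      rw [smul_add, smul_smul, mul_inv_cancel₀ ht, one_smul]
    exact eq_sub_of_add_eq' h4
  have hSR : ∀ y, S (R y) = t • S y - t • R y := by
    intro y
    obtain ⟨h, hy⟩ := hR₁ y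
    have h2 := hS₂ ⟨R y, h⟩
    have h3 : A ⟨R y, h⟩ - (c + t⁻¹) • R y = y - t⁻¹ • R y := by
      rw [add_smul, ← sub_sub, hy]
    simp only [h3, map_sub, map_smul] at h2
    have h4 : t • S y - S (R y) = t • R y := by
      nth_rw 2 [← h2]
      rw [smul_sub, smul_smul, mul_inv_cancel₀ ht, one_smul]
    rw [← h4]; abel
  -- Formally t - R = t(A - c - t⁻¹)R, whose inverse is t⁻¹(A - c)S = t⁻¹(1 + t⁻¹S).
  refine ⟨⟨algebraMap ℂ _ t - R, t⁻¹ • (1 + t⁻¹ • S), ?_, ?_⟩, rfl⟩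
  · ext y
    simp only [Algebra.algebraMap_eq_smul_one, mul_apply_eq_comp,
      sub_apply, smul_apply, add_apply,
      one_apply_eq_self, map_add, map_smul, hRS]
    match_scalars <;> field_simp <;> ring
  · ext y
    simp only [Algebra.algebraMap_eq_smul_one, mul_apply_eq_comp,
      sub_apply, smul_apply, add_apply,
      one_apply_eq_self, map_sub, map_smul, hSR]
    match_scalars <;> field_simp <;> ring

variable [CompleteSpace H]

theorem inner_apply_left {A : H →ₗ.[ℂ] H} (hA : IsSelfAdjoint A) (x y : A.domain) :
    inner ℂ (A x) (y : H) = inner ℂ (x : H) (A y) := by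
  have h := LinearPMap.adjoint_isFormalAdjoint hA.dense_domain
  rw [LinearPMap.isSelfAdjoint_def.mp hA] at h
  exact h x y

theorem im_eq_zero_of_eigenspace_ne_bot {A : H →ₗ.[ℂ] H} (hA : IsSelfAdjoint A) {z : ℂ}
    (hz : eigenspace A z ≠ ⊥) : z.im = 0 := by
  obtain ⟨u, hu, hu0⟩ := (Submodule.ne_bot_iff _).mp hz
  rw [mem_eigenspace_iff] at hu
  have h := inner_apply_left hA u u
  rw [hu, inner_smul_left, inner_smul_right] at h
  have h0 : inner ℂ (u : H) (u : H) ≠ 0 := by simpa using hu0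
  exact Complex.conj_eq_iff_im.mp (mul_right_cancel₀ h0 h)

theorem isSelfAdjoint_resolvent {A : H →ₗ.[ℂ] H} (hA : IsSelfAdjoint A) {c : ℝ} {R : H →L[ℂ] H}
    (hR : ∀ y : H, ∃ h : R y ∈ A.domain, A ⟨R y, h⟩ - (c : ℂ) • R y = y) :
    IsSelfAdjoint R := by
  rw [ContinuousLinearMap.isSelfAdjoint_iff_isSymmetric]
  intro x y
  obtain ⟨hx, hx'⟩ := hR x
  obtain ⟨hy, hy'⟩ := hR y
  have h := inner_apply_left hA ⟨R x, hx⟩ ⟨R y, hy⟩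
  change inner ℂ (R x) y = inner ℂ x (R y)
  nth_rw 2 [← hx']
  nth_rw 1 [← hy']
  simp only [inner_sub_left, inner_sub_right, inner_smul_left, inner_smul_right,
    Complex.conj_ofReal]
  simp only at h
  rw [h]

/-- A self-adjoint operator minus an isolated point of its spectrum is bounded below on the
orthogonal complement of the eigenspace. -/
theorem norm_le_norm_apply_sub_of_orthogonal {A : H →ₗ.[ℂ] H} (hA : IsSelfAdjoint A) {a d : ℝ}
    (hd : 0 < d) (hgap : ∀ w ∈ spec A, w ≠ (a : ℂ) → d ≤ ‖w - a‖) {v : A.domain}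
    (hv : ∀ u ∈ eigenspace A (a : ℂ), inner ℂ (u : H) (v : H) = 0) :
    3 / 4 * d * ‖(v : H)‖ ≤ ‖A v - (a : ℂ) • (v : H)‖ := by
  -- A real point inside the gap, so that the resolvent there is bounded and self-adjoint. Shifting
  -- back to `a` costs d/8, whence 3/4 = 7/8 - 1/8.
  set c : ℝ := a + d / 8 with hc
  have hcr : (c : ℂ) ∈ resolventSet A := by
    by_contra h
    have h1 := hgap c h (by
      intro h
      have := Complex.ofReal_injective h
      linarith)
    rw [← Complex.ofReal_sub, Complex.norm_real, hc, add_sub_cancel_left, Real.norm_eq_abs,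
      abs_of_pos (by linarith)] at h1
    linarith
  obtain ⟨R, hR₁, hR₂⟩ := hcr
  have hRsa := isSelfAdjoint_resolvent hA hR₁
  set r : ℝ := 8 / (7 * d) with hr
  have hr0 : 0 < r := by positivity
  have hspec : ∀ t ∈ spectrum ℝ R, t = -(8 / d) ∨ |t| ≤ r := by
    intro t ht
    by_cases ht0 : t = 0
    · right; simp [ht0, hr0.le]
    have ht' : (t : ℂ) ∈ spectrum ℂ R := by
      have := spectrum.algebraMap_mem ℂ ht
      simpa using this
    have hmem : (c : ℂ) + (t : ℂ)⁻¹ ∈ spec A := fun h =>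
      ht' (isUnit_resolvent_sub (by exact_mod_cast ht0) hR₁ hR₂ h)
    by_cases hta : (c : ℂ) + (t : ℂ)⁻¹ = a
    · left
      have h1 : c + t⁻¹ = a := by exact_mod_cast hta
      have h2 : t⁻¹ = -(d / 8) := by linarith
      rw [← inv_inv t, h2, inv_neg, inv_div]
    · right
      have h1 := hgap _ hmem hta
      have h2 : (c : ℂ) + (t : ℂ)⁻¹ - a = ((d / 8 + t⁻¹ : ℝ) : ℂ) := by
        rw [hc]; push_cast; ring
      rw [h2, Complex.norm_real, Real.norm_eq_abs] at h1
      have h3 : d ≤ d / 8 + |t|⁻¹ := by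
        rw [← abs_inv]
        refine h1.trans ((abs_add_le _ _).trans ?_)
        rw [abs_of_pos (by linarith : 0 < d / 8)]
      have h4 : 7 * d / 8 ≤ |t|⁻¹ := by linarith
      have h5 := inv_anti₀ (by positivity) h4
      rwa [inv_inv, inv_div] at h5
  -- Truncation at level r alters only the point -8/d = (a - c)⁻¹ of the spectrum of `R`. Hence (t +
  -- 8/d)(t - g t) vanishes on the spectrum, and `R - cfc g R` maps into the eigenspace.
  let g : ℝ → ℝ := fun t => max (-r) (min t r)
  have hg : Continuous g := by fun_prop
  have hgR : ‖cfc g R‖ ≤ r := by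
    refine norm_cfc_le hr0.le fun t _ => ?_
    rw [Real.norm_eq_abs, abs_le]
    exact ⟨le_max_left _ _, max_le (by linarith) (min_le_right _ _)⟩
  have hprod : (R + (8 / d) • (1 : H →L[ℂ] H)) * (R - cfc g R) = 0 := by
    have h1 : R - cfc g R = cfc (fun t : ℝ => t - g t) R := by
      rw [cfc_sub (fun t => t) g R, cfc_id' ℝ R]
    have h2 : R + (8 / d) • (1 : H →L[ℂ] H) = cfc (fun t : ℝ => t + 8 / d) R := by
      rw [cfc_add_const (8 / d) (fun t => t) R, cfc_id' ℝ R, Algebra.algebraMap_eq_smul_one]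
    rw [h1, h2, ← cfc_mul _ _ R]
    rw [← cfc_zero ℝ R]
    refine cfc_congr fun t ht => ?_
    rcases hspec t ht with h | h
    · simp [h]
    · rw [abs_le] at h
      simp [g, h.1, h.2]
  have hTsa : IsSelfAdjoint (R - cfc g R) := hRsa.sub (cfc_predicate g R)
  set T := R - cfc g R with hT
  have hRT : ∀ x, R (T x) = -(8 / d : ℂ) • T x := by
    intro x
    have h := congrArg (fun f : H →L[ℂ] H => f x) hprod
    simp only [mul_apply_eq_comp, add_apply,
      smul_apply, one_apply_eq_self,
      zero_apply] at h
    rw [eq_neg_of_add_eq_zero_left h, ← Complex.coe_smul, neg_smul]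
    push_cast
    rfl
  have hdC : (d : ℂ) ≠ 0 := by exact_mod_cast hd.ne'
  have hTmem : ∀ x, ∃ u ∈ eigenspace A (a : ℂ), (u : H) = T x := by
    intro x
    obtain ⟨h, hx⟩ := hR₁ (T x)
    refine ⟨-(d / 8 : ℂ) • ⟨R (T x), h⟩, ?_, ?_⟩
    · rw [mem_eigenspace_iff]
      rw [LinearPMap.map_smul, sub_eq_iff_eq_add.mp hx]
      simp only [Submodule.coe_smul, hRT, hc]
      push_cast
      match_scalars
      field_simp
      ring
    · simp only [Submodule.coe_smul, hRT, smul_smul]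
      rw [neg_mul_neg]
      field_simp
      simp
  set y : H := A v - (c : ℂ) • (v : H) with hy
  -- ‖Ty‖² = ⟨T(Ty), y⟩, where T(Ty) is an eigenvector and y = (A - c)v is orthogonal to the
  -- eigenspace because v is.
  have hTy : T y = 0 := by
    obtain ⟨u, hu, huT⟩ := hTmem (T y)
    rw [mem_eigenspace_iff] at hu
    rw [← inner_self_eq_zero (𝕜 := ℂ)]
    have h1 : inner ℂ (T (T y)) y = inner ℂ (T y) (T y) :=
      (ContinuousLinearMap.isSelfAdjoint_iff_isSymmetric.mp hTsa) (T y) y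
    have h2 := inner_apply_left hA u v
    have h3 := hv u (mem_eigenspace_iff.mpr hu)
    rw [← h1, ← huT, hy, inner_sub_right, inner_smul_right, ← h2, hu, inner_smul_left, h3]
    simp
  have hvy : (v : H) = cfc g R y := by
    have h1 := hR₂ v
    rw [← hy] at h1
    rw [← h1, ← sub_eq_zero, ← sub_apply, ← hT, hTy]
  have h1 : ‖(v : H)‖ ≤ r * ‖y‖ := by
    nth_rw 1 [hvy]
    exact (ContinuousLinearMap.le_opNorm _ _).trans (by gcongr)
  have h2 : 7 / 8 * d * ‖(v : H)‖ ≤ ‖y‖ := by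
    have h3 : 7 / 8 * d * (r * ‖y‖) = ‖y‖ := by
      rw [hr]; field_simp
    rw [← h3]; gcongr
  have h4 : ‖y‖ ≤ ‖A v - (a : ℂ) • (v : H)‖ + d / 8 * ‖(v : H)‖ := by
    have h5 : y = (A v - (a : ℂ) • (v : H)) - ((d / 8 : ℝ) : ℂ) • (v : H) := by
      rw [hy, hc]; push_cast; module
    rw [h5]
    refine (norm_sub_le _ _).trans ?_
    rw [norm_smul, Complex.norm_real, Real.norm_eq_abs, abs_of_pos (by linarith)]
  linarith

end Spectral

/-! ### The quadratic form, the projections and their defects. -/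

section Form

variable {H : Type*} [NormedAddCommGroup H] [InnerProductSpace ℂ H]

/-- The sesquilinear form `⟨(A - z̄) v, (A - z) w⟩`, linear in `w`. -/
def quadForm (A : H →ₗ.[ℂ] H) (z : ℂ) (v w : A.domain) : ℂ :=
  inner ℂ (A v) (A w) - 2 * z * inner ℂ (v : H) (A w) + z ^ 2 * inner ℂ (v : H) (w : H)

theorem quadForm_add_smul_right (A : H →ₗ.[ℂ] H) (z a : ℂ) (v w x : A.domain) :
    quadForm A z v (w + a • x) = quadForm A z v w + a * quadForm A z v x := by
  simp only [quadForm, LinearPMap.map_add, LinearPMap.map_smul, Submodule.coe_add,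
    Submodule.coe_smul, inner_add_right, inner_smul_right]
  ring

variable {A : H →ₗ.[ℂ] H} {L : Submodule ℂ H} (hL : L ≤ A.domain) {n : ℕ}
  (e : OrthonormalBasis (Fin n) ℂ L)

theorem coe_proj (u : H) : (proj hL e u : H) = ∑ k, inner ℂ (e k : H) u • (e k : H) := by
  simp [proj, basisVec]

theorem proj_mem (u : H) : (proj hL e u : H) ∈ L := by
  rw [coe_proj]
  exact Submodule.sum_mem _ fun k _ => L.smul_mem _ (e k).2

theorem proj_eq_self {w : A.domain} (hw : (w : H) ∈ L) : proj hL e (w : H) = w := by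
  ext
  rw [coe_proj]
  have h := congrArg (Submodule.subtype L) (e.sum_repr' ⟨w, hw⟩)
  simpa using h

theorem inner_proj {w : A.domain} (hw : (w : H) ∈ L) (u : H) :
    inner ℂ (w : H) (proj hL e u : H) = inner ℂ (w : H) u := by
  nth_rw 2 [← proj_eq_self hL e hw]
  rw [coe_proj, coe_proj, inner_sum, sum_inner]
  refine Finset.sum_congr rfl fun k _ => ?_
  rw [inner_smul_left, inner_smul_right, inner_conj_symm, mul_comm]

theorem norm_proj_le (u : H) : ‖(proj hL e u : H)‖ ≤ ‖u‖ := by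
  have h := inner_proj hL e (proj_mem hL e u) u
  rw [inner_self_eq_norm_sq_to_K] at h
  have h2 := norm_inner_le_norm (𝕜 := ℂ) (proj hL e u : H) u
  rw [← h] at h2
  simp only [Complex.coe_algebraMap, norm_pow, Complex.norm_real, norm_norm] at h2
  rcases (norm_nonneg (proj hL e u : H)).eq_or_lt with h0 | h0
  · rw [← h0]; exact norm_nonneg _
  · rw [sq] at h2
    exact le_of_mul_le_mul_left h2 h0

theorem apply_eq_sum {w : A.domain} (hw : (w : H) ∈ L) :
    A w = ∑ j, inner ℂ (e j : H) (w : H) • A (basisVec hL e j) := by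
  nth_rw 1 [← proj_eq_self hL e hw]
  rw [proj, ← LinearPMap.toFun_eq_coe, map_sum]
  simp

/-- Expanding w in the basis produces the vector appearing in (H). Symmetry could not replace this
for q = 1, since `x` may lie outside the domain, as AΠu may. -/
theorem inner_applyPow_eq (q : Fin 2) {w : A.domain} (hw : (w : H) ∈ L) (x : H) :
    inner ℂ (applyPow A q w) x =
      inner ℂ (w : H) (∑ j, inner ℂ (applyPow A q (basisVec hL e j)) x • (e j : H)) := by
  have h : applyPow A q w =
      ∑ j, inner ℂ (e j : H) (w : H) • applyPow A q (basisVec hL e j) := by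
    by_cases hq : q = 0
    · subst hq
      simp only [applyPow, if_true]
      nth_rw 1 [← proj_eq_self hL e hw]
      rw [coe_proj]
      rfl
    · simp only [applyPow, hq, if_false]
      exact apply_eq_sum hL e hw
  rw [h, sum_inner, inner_sum]
  refine Finset.sum_congr rfl fun k _ => ?_
  rw [inner_smul_left, inner_smul_right, inner_conj_symm, mul_comm]

/-- The defect `∑ⱼ ⟨A^p Π u, A^q eⱼ⟩ eⱼ - z^(p+q) u`. -/
def defect (z : ℂ) (p q : Fin 2) (u : H) : H :=
  ∑ j, inner ℂ (applyPow A q (basisVec hL e j)) (applyPow A p (proj hL e u)) • (e j : H)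
    - z ^ (p.val + q.val) • u

theorem inner_applyPow_proj (z : ℂ) (p q : Fin 2) {w : A.domain} (hw : (w : H) ∈ L) (u : H) :
    inner ℂ (applyPow A q w) (applyPow A p (proj hL e u)) =
      z ^ (p.val + q.val) * inner ℂ (w : H) u + inner ℂ (w : H) (defect hL e z p q u) := by
  rw [inner_applyPow_eq hL e q hw, defect, inner_sub_right, inner_smul_right]
  ring

theorem proj_smul (c : ℂ) (u : H) : proj hL e (c • u) = c • proj hL e u := by
  simp only [proj, inner_smul_right, Finset.smul_sum, smul_smul]

theorem proj_add (u v : H) : proj hL e (u + v) = proj hL e u + proj hL e v := by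
  simp only [proj, inner_add_right, add_smul, Finset.sum_add_distrib]

theorem applyPow_add (p : Fin 2) (x y : A.domain) :
    applyPow A p (x + y) = applyPow A p x + applyPow A p y := by
  unfold applyPow; split_ifs <;> simp [LinearPMap.map_add]

theorem applyPow_smul (p : Fin 2) (c : ℂ) (x : A.domain) :
    applyPow A p (c • x) = c • applyPow A p x := by
  unfold applyPow; split_ifs <;> simp [LinearPMap.map_smul]

theorem defect_zero_zero (z : ℂ) (u : H) :
    defect hL e z 0 0 u = (proj hL e u : H) - u := by
  have h := coe_proj hL e (proj hL e u : H)
  rw [proj_eq_self hL e (proj_mem hL e u)] at h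
  rw [h]
  simp [defect, applyPow, basisVec]

/-- The defect as a linear map on the domain. -/
def defectMap (z : ℂ) (p q : Fin 2) : A.domain →ₗ[ℂ] H where
  toFun u := defect hL e z p q (u : H)
  map_add' u v := by
    simp only [defect, Submodule.coe_add, proj_add, applyPow_add, inner_add_right, add_smul,
      smul_add, Finset.sum_add_distrib]
    abel
  map_smul' c u := by
    simp only [defect, Submodule.coe_smul, proj_smul, applyPow_smul, inner_smul_right,
      RingHom.id_apply, smul_sub, Finset.smul_sum, smul_smul]
    rw [mul_comm c]

/-- The main terms of the three pairings combine to λ² - 2zλ + z² = (z - λ)²; only the defects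
remain. -/
theorem norm_quadForm_proj_sub_le [CompleteSpace H] (hA : IsSelfAdjoint A) (z lam : ℂ) {v : A.domain} (hv : (v : H) ∈ L) (u : H) :
    ‖quadForm A z v (proj hL e u) - (z - lam) ^ 2 * inner ℂ (v : H) u‖ ≤
      (‖defect hL e lam 1 1 u‖ + 2 * ‖z‖ * ‖defect hL e lam 0 1 u‖ +
        ‖z‖ ^ 2 * ‖defect hL e lam 0 0 u‖) * ‖(v : H)‖ := by
  have h11 := inner_applyPow_proj hL e lam 1 1 hv u
  have h01 := inner_applyPow_proj hL e lam 0 1 hv u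
  have h00 := inner_applyPow_proj hL e lam 0 0 hv u
  simp only [applyPow, one_ne_zero, if_false, if_true, Fin.val_one, Fin.val_zero, zero_add,
    pow_zero, pow_one, one_mul] at h11 h01 h00
  have h : quadForm A z v (proj hL e u) - (z - lam) ^ 2 * inner ℂ (v : H) u =
      inner ℂ (v : H) (defect hL e lam 1 1 u) - 2 * z * inner ℂ (v : H) (defect hL e lam 0 1 u)
        + z ^ 2 * inner ℂ (v : H) (defect hL e lam 0 0 u) := by
    rw [quadForm, ← inner_apply_left hA, h11, h01, h00]
    ring
  rw [h]
  have hb : ∀ x : H, ‖inner ℂ (v : H) x‖ ≤ ‖(v : H)‖ * ‖x‖ := fun x => norm_inner_le_norm _ _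
  calc _ ≤ ‖inner ℂ (v : H) (defect hL e lam 1 1 u)‖
        + ‖2 * z * inner ℂ (v : H) (defect hL e lam 0 1 u)‖
        + ‖z ^ 2 * inner ℂ (v : H) (defect hL e lam 0 0 u)‖ :=
        (norm_add_le _ _).trans (by gcongr; exact norm_sub_le _ _)
    _ ≤ ‖(v : H)‖ * ‖defect hL e lam 1 1 u‖
        + 2 * ‖z‖ * (‖(v : H)‖ * ‖defect hL e lam 0 1 u‖)
        + ‖z‖ ^ 2 * (‖(v : H)‖ * ‖defect hL e lam 0 0 u‖) := by
      simp only [norm_mul, norm_pow, Complex.norm_ofNat]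
      gcongr <;> exact hb _
    _ = _ := by ring

end Form

/-! ### Uniformity of (H) over the eigenspace. -/

section Defect

variable {H : Type*} [NormedAddCommGroup H] [InnerProductSpace ℂ H]

/-- A sequence of linear maps on a finite-dimensional subspace that tends to zero pointwise
tends to zero uniformly on bounded sets. -/
theorem eventually_norm_le_mul_norm {D F : Type*} [NormedAddCommGroup D] [InnerProductSpace ℂ D]
    [NormedAddCommGroup F] [NormedSpace ℂ F] (E : Submodule ℂ D) [FiniteDimensional ℂ E]
    (T : ℕ → D →ₗ[ℂ] F) (hT : ∀ u ∈ E, Tendsto (fun n => ‖T n u‖) atTop (𝓝 0))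
    {η : ℝ} (hη : 0 < η) : ∀ᶠ n in atTop, ∀ u ∈ E, ‖T n u‖ ≤ η * ‖u‖ := by
  let b := stdOrthonormalBasis ℂ E
  have h : Tendsto (fun n => ∑ i, ‖T n (b i)‖) atTop (𝓝 0) := by
    rw [← Finset.sum_const_zero (s := Finset.univ) (ι := Fin (Module.finrank ℂ E))]
    exact tendsto_finsetSum _ fun i _ => hT _ (b i).2
  filter_upwards [h.eventually (gt_mem_nhds hη)] with n hn u hu
  have h1 : u = ∑ i, inner ℂ (b i) (⟨u, hu⟩ : E) • (b i : D) := by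
    have := congrArg (Submodule.subtype E) (b.sum_repr' ⟨u, hu⟩)
    simpa using this.symm
  have h2 : T n u = ∑ i, inner ℂ (b i) (⟨u, hu⟩ : E) • T n (b i) := by
    nth_rw 1 [h1]; simp
  rw [h2]
  calc _ ≤ ∑ i, ‖inner ℂ (b i) (⟨u, hu⟩ : E) • T n (b i)‖ := norm_sum_le _ _
    _ ≤ ∑ i, ‖u‖ * ‖T n (b i)‖ := by
      refine Finset.sum_le_sum fun i _ => ?_
      rw [norm_smul]
      gcongr
      refine (norm_inner_le_norm _ _).trans ?_
      rw [b.norm_eq_one, one_mul]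
      rfl
    _ ≤ η * ‖u‖ := by
      rw [← Finset.mul_sum, mul_comm]
      gcongr

theorem eventually_norm_quadForm_proj_sub_le [CompleteSpace H] {A : H →ₗ.[ℂ] H}
    (hA : IsSelfAdjoint A)
    {L : ℕ → Submodule ℂ H} (hL : ∀ n, L n ≤ A.domain)
    (e : ∀ n, OrthonormalBasis (Fin n) ℂ (L n)) {lam : ℂ}
    [FiniteDimensional ℂ (eigenspace A lam)]
    (hH : HypothesisH A hL e lam) {M η : ℝ} (hM : 0 ≤ M) (hη : 0 < η) :
    ∀ᶠ n in atTop, ∀ z : ℂ, ‖z‖ ≤ M → ∀ v : A.domain, (v : H) ∈ L n →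
      ∀ u ∈ eigenspace A lam,
        ‖quadForm A z v (proj (hL n) (e n) (u : H)) - (z - lam) ^ 2 * inner ℂ (v : H) (u : H)‖ ≤
          η * ‖(u : H)‖ * ‖(v : H)‖ := by
  have hη' : 0 < η / (1 + 2 * M + M ^ 2) := by positivity
  have key : ∀ p q : Fin 2, ∀ᶠ n in atTop, ∀ u ∈ eigenspace A lam,
      ‖defect (hL n) (e n) lam p q (u : H)‖ ≤ η / (1 + 2 * M + M ^ 2) * ‖(u : H)‖ := fun p q =>
    eventually_norm_le_mul_norm (eigenspace A lam) (fun n => defectMap (hL n) (e n) lam p q)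
      (fun u hu => hH p q u (mem_eigenspace_iff.mp hu)) hη'
  filter_upwards [key 1 1, key 0 1, key 0 0] with n h11 h01 h00 z hz v hv u hu
  refine (norm_quadForm_proj_sub_le (hL n) (e n) hA z lam hv (u : H)).trans ?_
  gcongr
  calc _ ≤ η / (1 + 2 * M + M ^ 2) * ‖(u : H)‖
        + 2 * M * (η / (1 + 2 * M + M ^ 2) * ‖(u : H)‖)
        + M ^ 2 * (η / (1 + 2 * M + M ^ 2) * ‖(u : H)‖) := by
        gcongr
        exacts [h11 u hu, h01 u hu, h00 u hu]
    _ = η * ‖(u : H)‖ := by field_simp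

end Defect

/-! ### The inf-sup condition on the annulus. -/

section InfSup

variable {H : Type*} [NormedAddCommGroup H] [InnerProductSpace ℂ H]

theorem conj_quadForm (A : H →ₗ.[ℂ] H) [CompleteSpace H] (hA : IsSelfAdjoint A) (z : ℂ)
    (v w : A.domain) :
    starRingEnd ℂ (quadForm A z v w) = quadForm A (starRingEnd ℂ z) w v := by
  simp only [quadForm, map_add, map_sub, map_mul, map_pow, inner_conj_symm, map_ofNat,
    inner_apply_left hA]

variable [CompleteSpace H] {A : H →ₗ.[ℂ] H}

/-- The cross terms vanish because the eigenspace is invariant and `A` is symmetric. -/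
theorem quadForm_self_eq (hA : IsSelfAdjoint A) (a : ℝ) (z : ℂ) {p v : A.domain}
    (hp : p ∈ eigenspace A (a : ℂ)) (hpv : inner ℂ (p : H) (v : H) = 0) :
    quadForm A z (p + v) (p + v) = (‖A v - (a : ℂ) • (v : H)‖ ^ 2 : ℝ)
      - 2 * (z - a) * inner ℂ (v : H) (A v - (a : ℂ) • (v : H))
      + (z - a) ^ 2 * (‖(v : H)‖ ^ 2 : ℝ) + (z - a) ^ 2 * (‖(p : H)‖ ^ 2 : ℝ) := by
  rw [mem_eigenspace_iff] at hp
  have hvp : inner ℂ (v : H) (p : H) = 0 := inner_eq_zero_symm.mp hpv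
  have hpA : inner ℂ (p : H) (A v) = 0 := by
    rw [← inner_apply_left hA, hp, inner_smul_left, hpv, mul_zero]
  have hAp : inner ℂ (A v) (p : H) = 0 := inner_eq_zero_symm.mp hpA
  have hs : inner ℂ (A v) (v : H) = inner ℂ (v : H) (A v) := inner_apply_left hA v v
  have hn : ∀ x : H, ((‖x‖ ^ 2 : ℝ) : ℂ) = inner ℂ x x := fun x => by
    rw [inner_self_eq_norm_sq_to_K]; simp
  simp only [quadForm, hn, LinearPMap.map_add, hp, Submodule.coe_add, inner_add_left,
    inner_add_right, inner_sub_left, inner_sub_right, inner_smul_left, inner_smul_right,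
    Complex.conj_ofReal, hpv, hvp, hpA, hAp, hs]
  ring

/-- An inf-sup condition for the form on the annulus `r ≤ |z - a| ≤ d / 4`. -/
theorem exists_mul_norm_sq_le_norm_quadForm (hA : IsSelfAdjoint A) {a d r η : ℝ} (hr : 0 < r)
    (hrd : r ≤ d / 8) (hη : η ≤ r ^ 2 / 4)
    (hgap : ∀ w ∈ spec A, w ≠ (a : ℂ) → d ≤ ‖w - a‖)
    [FiniteDimensional ℂ (eigenspace A (a : ℂ))]
    {L : Submodule ℂ H} (hL : L ≤ A.domain) {n : ℕ} (e : OrthonormalBasis (Fin n) ℂ L)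
    {z : ℂ} (hrz : r ≤ ‖z - a‖) (hzd : ‖z - a‖ ≤ d / 4)
    (herr : ∀ v : A.domain, (v : H) ∈ L → ∀ u ∈ eigenspace A (a : ℂ),
      ‖quadForm A z v (proj hL e (u : H)) - (z - a) ^ 2 * inner ℂ (v : H) (u : H)‖ ≤
        η * ‖(u : H)‖ * ‖(v : H)‖)
    {v : A.domain} (hv : (v : H) ∈ L) :
    ∃ w : A.domain, (w : H) ∈ L ∧ ‖(w : H)‖ ≤ 3 * ‖(v : H)‖ ∧
      r ^ 2 / 2 * ‖(v : H)‖ ^ 2 ≤ ‖quadForm A z v w‖ := by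
  -- The splitting takes place inside the domain with the norm of `H`; finite multiplicity provides
  -- the projection even if the domain is not complete.
  obtain ⟨p, hp, v', hv', hvp⟩ := (eigenspace A (a : ℂ)).exists_add_mem_mem_orthogonal v
  have hd : 0 < d := by linarith
  have horth : ∀ u ∈ eigenspace A (a : ℂ), inner ℂ (u : H) (v' : H) = 0 := fun u hu =>
    (Submodule.mem_orthogonal _ _).mp hv' u hu
  have hlow := norm_le_norm_apply_sub_of_orthogonal hA hd hgap horth
  have hself := quadForm_self_eq hA a z hp (horth p hp)
  rw [← hvp] at hself
  have hnorm : ‖(v : H)‖ ^ 2 = ‖(p : H)‖ ^ 2 + ‖(v' : H)‖ ^ 2 := by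
    rw [hvp, Submodule.coe_add, sq, sq, sq]
    exact norm_add_sq_eq_norm_sq_add_norm_sq_of_inner_eq_zero _ _ (horth p hp)
  have hpv : ‖(p : H)‖ ≤ ‖(v : H)‖ := by
    refine le_of_sq_le_sq ?_ (norm_nonneg _)
    rw [hnorm]; linarith [sq_nonneg ‖(v' : H)‖]
  have hinner : inner ℂ (v : H) (p : H) = ((‖(p : H)‖ ^ 2 : ℝ) : ℂ) := by
    rw [hvp, Submodule.coe_add, inner_add_left, inner_eq_zero_symm.mp (horth p hp), add_zero,
      inner_self_eq_norm_sq_to_K]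
    simp
  set ζ : ℂ := z - a with hζ
  have hζ0 : ζ ≠ 0 := by
    rw [← norm_pos_iff]; linarith
  -- The unimodular factor that rotates ζ² onto the positive axis.
  set θ : ℂ := starRingEnd ℂ (ζ ^ 2) / (‖ζ‖ ^ 2 : ℝ) with hθ
  have hζn : 0 < ‖ζ‖ := norm_pos_iff.mpr hζ0
  have hθζ : θ * ζ ^ 2 = ((‖ζ‖ ^ 2 : ℝ) : ℂ) := by
    have h1 : starRingEnd ℂ (ζ ^ 2) * ζ ^ 2 = ((‖ζ‖ ^ 2 : ℝ) : ℂ) ^ 2 := by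
      rw [Complex.conj_mul', norm_pow]
    have h2 : ((‖ζ‖ ^ 2 : ℝ) : ℂ) ≠ 0 := by
      exact_mod_cast (pow_pos hζn 2).ne'
    rw [hθ, div_mul_eq_mul_div, h1, sq, mul_div_assoc, div_self h2, mul_one]
  have hθn : ‖θ‖ = 1 := by
    rw [hθ, norm_div, Complex.norm_conj, norm_pow, Complex.norm_real, norm_pow, norm_norm,
      div_self (pow_pos hζn 2).ne']
  have hθ1 : ‖θ - 1‖ ≤ 2 := (norm_sub_le _ _).trans (by rw [hθn, norm_one]; norm_num)
  -- The ideal test vector θp + v' need not lie in `L`, so p is replaced by its projection in the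
  -- correction.
  refine ⟨v + (θ - 1) • proj hL e (p : H), ?_, ?_, ?_⟩
  · exact L.add_mem hv (L.smul_mem _ (proj_mem hL e _))
  · rw [Submodule.coe_add, Submodule.coe_smul]
    refine (norm_add_le _ _).trans ?_
    rw [norm_smul]
    have h1 := norm_proj_le hL e (p : H)
    have h2 : ‖θ - 1‖ * ‖(proj hL e (p : H) : H)‖ ≤ 2 * ‖(v : H)‖ := by
      gcongr; exact h1.trans hpv
    linarith
  · set s : H := A v' - (a : ℂ) • (v' : H) with hs
    set E : ℂ := quadForm A z v (proj hL e (p : H)) - ζ ^ 2 * inner ℂ (v : H) (p : H) with hE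
    have hEn : ‖E‖ ≤ η * ‖(p : H)‖ * ‖(v : H)‖ := herr v hv p hp
    have hform : quadForm A z v (v + (θ - 1) • proj hL e (p : H)) =
        ((‖s‖ ^ 2 + ‖ζ‖ ^ 2 * ‖(p : H)‖ ^ 2 : ℝ) : ℂ) +
          (-(2 * ζ * inner ℂ (v' : H) s) + ζ ^ 2 * (‖(v' : H)‖ ^ 2 : ℝ) + (θ - 1) * E) := by
      rw [quadForm_add_smul_right, hself, hE, hinner]
      push_cast at hθζ ⊢
      linear_combination (‖(p : H)‖ : ℂ) ^ 2 * hθζ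
    have hrest : ‖-(2 * ζ * inner ℂ (v' : H) s) + ζ ^ 2 * (‖(v' : H)‖ ^ 2 : ℝ) + (θ - 1) * E‖ ≤
        2 * (‖ζ‖ * ‖(v' : H)‖) * ‖s‖ + (‖ζ‖ * ‖(v' : H)‖) ^ 2 + r ^ 2 / 2 * ‖(v : H)‖ ^ 2 := by
      refine (norm_add₃_le).trans ?_
      have h1 : ‖-(2 * ζ * inner ℂ (v' : H) s)‖ ≤ 2 * (‖ζ‖ * ‖(v' : H)‖) * ‖s‖ := by
        rw [norm_neg, norm_mul, norm_mul, Complex.norm_ofNat]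
        calc _ ≤ 2 * ‖ζ‖ * (‖(v' : H)‖ * ‖s‖) := by gcongr; exact norm_inner_le_norm _ _
          _ = _ := by ring
      have h2 : ‖ζ ^ 2 * ((‖(v' : H)‖ ^ 2 : ℝ) : ℂ)‖ = (‖ζ‖ * ‖(v' : H)‖) ^ 2 := by
        rw [norm_mul, norm_pow, Complex.norm_real, norm_pow, norm_norm, mul_pow]
      have h3 : ‖(θ - 1) * E‖ ≤ r ^ 2 / 2 * ‖(v : H)‖ ^ 2 := by
        rw [norm_mul]
        calc _ ≤ 2 * (r ^ 2 / 4 * ‖(v : H)‖ * ‖(v : H)‖) := by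
              gcongr
              exact hEn.trans (by gcongr)
          _ = _ := by ring
      linarith
    -- This is where |ζ| ≤ d/4 meets the gap constant 3d/4. The indefinite terms then cost at most
    -- (2/3 + 1/9)‖s‖², leaving 2/9 ‖s‖² to control v'.
    have hx : ‖ζ‖ * ‖(v' : H)‖ ≤ ‖s‖ / 3 := by
      have h1 : ‖ζ‖ * ‖(v' : H)‖ ≤ d / 4 * ‖(v' : H)‖ := by gcongr
      linarith
    have hx0 : 0 ≤ ‖ζ‖ * ‖(v' : H)‖ := by positivity
    have hsv : r ^ 2 * ‖(v' : H)‖ ^ 2 ≤ 2 / 9 * ‖s‖ ^ 2 := by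
      have h1 : 6 * (r * ‖(v' : H)‖) ≤ ‖s‖ := by
        refine le_trans ?_ hlow
        have : r * ‖(v' : H)‖ ≤ d / 8 * ‖(v' : H)‖ := by gcongr
        linarith
      have h2 : 0 ≤ r * ‖(v' : H)‖ := by positivity
      nlinarith
    have hpp : r ^ 2 * ‖(p : H)‖ ^ 2 ≤ ‖ζ‖ ^ 2 * ‖(p : H)‖ ^ 2 := by gcongr
    rw [hform]
    refine le_trans ?_ (norm_sub_le_norm_add _ _)
    rw [Complex.norm_real, Real.norm_eq_abs, abs_of_nonneg (by positivity)]
    have h5 : 2 * (‖ζ‖ * ‖(v' : H)‖) * ‖s‖ + (‖ζ‖ * ‖(v' : H)‖) ^ 2 ≤ 7 / 9 * ‖s‖ ^ 2 := by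
      have h6 := mul_le_mul_of_nonneg_right hx (norm_nonneg s)
      have h7 := pow_le_pow_left₀ hx0 hx 2
      nlinarith
    rw [hnorm] at hrest ⊢
    linarith

end InfSup

/-! ### From the form to matrices. -/

section Coordinates

variable {H : Type*} [NormedAddCommGroup H] [InnerProductSpace ℂ H] {n : ℕ}

/-- The index convention of the coefficient matrices conjugates both coordinate vectors and
exchanges their slots. -/
theorem inner_toEuclideanCLM_of_inner (X Y : Fin n → H) (x y : EuclideanSpace ℂ (Fin n)) :
    inner ℂ y (Matrix.toEuclideanCLM (n := Fin n) (𝕜 := ℂ)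
      (Matrix.of fun j k => inner ℂ (X k) (Y j)) x) =
      inner ℂ (∑ k, star (x k) • X k) (∑ j, star (y j) • Y j) := by
  simp only [PiLp.inner_apply, Matrix.ofLp_toEuclideanCLM, Matrix.mulVec, dotProduct,
    Matrix.of_apply, inner_sum, sum_inner, inner_smul_left, inner_smul_right, RCLike.inner_apply,
    Finset.sum_mul, Finset.mul_sum]
  refine Finset.sum_congr rfl fun j _ => Finset.sum_congr rfl fun k _ => ?_
  simp only [RCLike.star_def, Complex.conj_conj]
  ring

variable {A : H →ₗ.[ℂ] H} {L : Submodule ℂ H} (hL : L ≤ A.domain)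
  (e : OrthonormalBasis (Fin n) ℂ L)

/-- The vector of `L` whose coordinates are the complex conjugates of those of `x`. -/
def coordVec (x : EuclideanSpace ℂ (Fin n)) : A.domain :=
  Submodule.inclusion hL (e.repr.symm (WithLp.toLp 2 fun k => star (x k)))

theorem coordVec_mem (x : EuclideanSpace ℂ (Fin n)) : (coordVec hL e x : H) ∈ L :=
  (e.repr.symm (WithLp.toLp 2 fun k => star (x k))).2

theorem norm_coordVec (x : EuclideanSpace ℂ (Fin n)) : ‖(coordVec hL e x : H)‖ = ‖x‖ := by
  have h : ‖(coordVec hL e x : H)‖ = ‖e.repr.symm (WithLp.toLp 2 fun k => star (x k))‖ := rfl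
  rw [h, LinearIsometryEquiv.norm_map, EuclideanSpace.norm_eq, EuclideanSpace.norm_eq]
  simp only [norm_star]

theorem exists_coordVec_eq {w : A.domain} (hw : (w : H) ∈ L) : ∃ x, coordVec hL e x = w := by
  refine ⟨WithLp.toLp 2 fun k => star (e.repr ⟨w, hw⟩ k), ?_⟩
  simp only [coordVec, star_star, WithLp.toLp_ofLp, LinearIsometryEquiv.symm_apply_apply]
  rfl

theorem coordVec_eq_sum (x : EuclideanSpace ℂ (Fin n)) :
    coordVec hL e x = ∑ k, star (x k) • basisVec hL e k := by
  rw [coordVec, ← e.sum_repr_symm, map_sum]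
  simp [basisVec]

/-- The quadratic matrix pencil with coefficients `B`. -/
def pencil (B : Fin 3 → Matrix (Fin n) (Fin n) ℂ) (z : ℂ) :
    EuclideanSpace ℂ (Fin n) →L[ℂ] EuclideanSpace ℂ (Fin n) :=
  Matrix.toEuclideanCLM (n := Fin n) (𝕜 := ℂ) (B 0 - (2 * z) • B 1 + z ^ 2 • B 2)

theorem pencil_eq (B : Fin 3 → Matrix (Fin n) (Fin n) ℂ) (z : ℂ) :
    pencil B z = Matrix.toEuclideanCLM (n := Fin n) (𝕜 := ℂ) (B 0)
      - (2 * z) • Matrix.toEuclideanCLM (n := Fin n) (𝕜 := ℂ) (B 1)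
      + z ^ 2 • Matrix.toEuclideanCLM (n := Fin n) (𝕜 := ℂ) (B 2) := by
  simp [pencil]

theorem isUnit_pencil_iff {B : Fin 3 → Matrix (Fin n) (Fin n) ℂ} {z : ℂ} :
    IsUnit (pencil B z) ↔ z ∉ quadraticRoots B := by
  rw [pencil, MulEquiv.isUnit_map, Matrix.isUnit_iff_isUnit_det, isUnit_iff_ne_zero]
  rfl

theorem differentiable_pencil (B : Fin 3 → Matrix (Fin n) (Fin n) ℂ) :
    Differentiable ℂ (pencil B) := by
  rw [funext (pencil_eq B)]
  fun_prop

theorem norm_pencil_sub_le {B C : Fin 3 → Matrix (Fin n) (Fin n) ℂ} {ε M : ℝ}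
    (h : ∀ p, opNorm (B p - C p) ≤ ε) {z : ℂ} (hz : ‖z‖ ≤ M) :
    ‖pencil B z - pencil C z‖ ≤ ε * (1 + 2 * M + M ^ 2) := by
  have hε : 0 ≤ ε := (norm_nonneg _).trans (h 0)
  have h1 : pencil B z - pencil C z = pencil (fun p => B p - C p) z := by
    simp only [pencil_eq, map_sub]; module
  rw [h1, pencil_eq]
  calc _ ≤ opNorm (B 0 - C 0) + ‖2 * z‖ * opNorm (B 1 - C 1) + ‖z ^ 2‖ * opNorm (B 2 - C 2) := by
        refine (norm_add_le _ _).trans (add_le_add ((norm_sub_le _ _).trans ?_)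
          (norm_smul _ _).le)
        exact add_le_add le_rfl (norm_smul _ _).le
    _ ≤ ε + 2 * M * ε + M ^ 2 * ε := by
        rw [norm_mul, Complex.norm_ofNat, norm_pow]
        have hM : 0 ≤ M := (norm_nonneg z).trans hz
        gcongr
        exacts [h 0, norm_nonneg _, h 1, norm_nonneg _, h 2]
    _ = _ := by ring

theorem inner_pencil_coeffMatrix (z : ℂ) (x y : EuclideanSpace ℂ (Fin n)) :
    inner ℂ y (pencil (coeffMatrix A hL e) z x) =
      quadForm A z (coordVec hL e x) (coordVec hL e y) := by
  have h1 : ∀ x, (coordVec hL e x : H) = ∑ k, star (x k) • (basisVec hL e k : H) := fun x => by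
    rw [coordVec_eq_sum]; simp
  have h2 : ∀ x, A (coordVec hL e x) = ∑ k, star (x k) • A (basisVec hL e k) := fun x => by
    rw [coordVec_eq_sum, ← LinearPMap.toFun_eq_coe, map_sum]; simp
  have hAv : ∀ x y : EuclideanSpace ℂ (Fin n), inner ℂ y (Matrix.toEuclideanCLM (n := Fin n)
      (𝕜 := ℂ) (coeffMatrix A hL e 1) x) =
      inner ℂ (coordVec hL e x : H) (A (coordVec hL e y)) := fun x y => by
    rw [h1, h2]
    exact inner_toEuclideanCLM_of_inner (fun k => (basisVec hL e k : H))
      (fun j => A (basisVec hL e j)) x y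
  have hAA : inner ℂ y (Matrix.toEuclideanCLM (n := Fin n)
      (𝕜 := ℂ) (coeffMatrix A hL e 0) x) =
      inner ℂ (A (coordVec hL e x)) (A (coordVec hL e y)) := by
    rw [h2, h2]
    exact inner_toEuclideanCLM_of_inner (fun k => A (basisVec hL e k))
      (fun j => A (basisVec hL e j)) x y
  have hvv : inner ℂ y (Matrix.toEuclideanCLM (n := Fin n)
      (𝕜 := ℂ) (coeffMatrix A hL e 2) x) =
      inner ℂ (coordVec hL e x : H) (coordVec hL e y : H) := by
    rw [h1, h1]
    exact inner_toEuclideanCLM_of_inner (fun k => (basisVec hL e k : H))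
      (fun j => (basisVec hL e j : H)) x y
  rw [pencil_eq]
  simp only [add_apply, sub_apply, smul_apply, inner_add_right, inner_sub_right, inner_smul_right,
    hAv, hAA, hvv, quadForm]

end Coordinates

/-! ### The maximum principle for inverses. -/

/-- A bound below for a holomorphic family of invertible operators on the boundary of a disc
propagates to the centre. -/
theorem mul_norm_le_of_sphere {V : Type*} [NormedAddCommGroup V] [NormedSpace ℂ V]
    [CompleteSpace V] {T : ℂ → V →L[ℂ] V} (hT : Differentiable ℂ T) {c : ℂ} {r κ : ℝ}
    (hr : 0 < r) (hκ : 0 < κ) (hunit : ∀ z ∈ Metric.closedBall c r, IsUnit (T z))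
    (hbound : ∀ z ∈ Metric.sphere c r, ∀ x, κ * ‖x‖ ≤ ‖T z x‖) (x : V) :
    κ * ‖x‖ ≤ ‖T c x‖ := by
  have hinv : ∀ z ∈ Metric.closedBall c r, ∀ y, T z (Ring.inverse (T z) y) = y := by
    intro z hz y
    rw [← mul_apply_eq_comp, Ring.mul_inverse_cancel _ (hunit z hz), one_apply_eq_self]
  -- Holomorphic on the disc, equal to x at the centre, and at most ‖T c x‖ / κ in norm on the
  -- circle.
  let f : ℂ → V := fun z => Ring.inverse (T z) (T c x)
  have hf : DiffContOnCl ℂ f (Metric.ball c r) := by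
    refine DifferentiableOn.diffContOnCl fun z hz => ?_
    rw [closure_ball c hr.ne'] at hz
    refine DifferentiableAt.differentiableWithinAt ?_
    exact ((differentiableAt_inverse (𝕜 := ℂ) (hunit z hz)).comp z (hT z)).clm_apply
      (differentiableAt_const _)
  have hcr : c ∈ Metric.closedBall c r := Metric.mem_closedBall_self hr.le
  have h := Complex.norm_le_of_forall_mem_frontier_norm_le Metric.isBounded_ball hf
    (C := ‖T c x‖ / κ) (fun z hz => by
      rw [frontier_ball c hr.ne'] at hz
      rw [le_div_iff₀' hκ]
      refine (hbound z hz _).trans ?_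
      rw [hinv z (Metric.sphere_subset_closedBall hz)]) (z := c)
      (by rwa [closure_ball c hr.ne'])
  rw [le_div_iff₀' hκ] at h
  have h2 : f c = x := by
    change Ring.inverse (T c) (T c x) = x
    rw [← mul_apply_eq_comp, Ring.inverse_mul_cancel _ (hunit c hcr), one_apply_eq_self]
  rwa [h2] at h

end QuadraticMethod

end

/-! ### Stability and localisation of the roots. -/

open QuadraticMethod

theorem mainTheorem3 {H : Type*} [NormedAddCommGroup H] [InnerProductSpace ℂ H] [CompleteSpace H]
    (A : H →ₗ.[ℂ] H) (hA : IsSelfAdjoint A)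
    (L : ℕ → Submodule ℂ H) (hL : ∀ n, L n ≤ A.domain)
    (e : ∀ n, OrthonormalBasis (Fin n) ℂ (L n))
    (lam : ℂ) (hlam : lam ∈ QuadraticMethod.discreteSpec A)
    (hH : QuadraticMethod.HypothesisH A hL e lam)
    (d : ℝ) (hd : d = Metric.infDist lam (QuadraticMethod.spec A \ {lam}))
    (δ : ℝ) (hδ0 : 0 < δ) (hδ : δ < d / 4) :
    ∃ N : ℕ, 0 < N ∧ ∃ ε : Fin 3 → ℝ, (∀ p, 0 < ε p) ∧
      ∀ n > N, ∀ B : Fin 3 → Matrix (Fin n) (Fin n) ℂ,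
        (∀ p, QuadraticMethod.opNorm
          (B p - QuadraticMethod.coeffMatrix A (hL n) (e n) p) < ε p) →
        (∃ ζ ∈ QuadraticMethod.quadraticRoots B, ‖ζ - lam‖ < δ) ∧
        Disjoint (QuadraticMethod.quadraticRoots B)
          {w : ℂ | δ < ‖w - lam‖ ∧ ‖w - lam‖ ≤ d / 4} := by
  obtain ⟨-, -, hne, hfin⟩ := hlam
  obtain ⟨a, rfl⟩ : ∃ a : ℝ, lam = a :=
    ⟨lam.re, Complex.ext rfl (im_eq_zero_of_eigenspace_ne_bot hA hne)⟩
  have hgap : ∀ w ∈ spec A, w ≠ (a : ℂ) → d ≤ ‖w - a‖ := fun w hw hwa => by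
    rw [hd, ← dist_eq_norm, dist_comm]
    exact Metric.infDist_le_dist_of_mem ⟨hw, hwa⟩
  obtain ⟨u, hu, hu0⟩ := (Submodule.ne_bot_iff _).mp hne
  have hu0' : 0 < ‖(u : H)‖ := by simpa using hu0
  set r : ℝ := δ / 2 with hr
  have hr0 : 0 < r := by positivity
  set M : ℝ := ‖(a : ℂ)‖ + d / 4 with hM
  have hM0 : 0 ≤ M := by have := norm_nonneg (a : ℂ); linarith
  have hzM : ∀ z : ℂ, ‖z - a‖ ≤ d / 4 → ‖z‖ ≤ M := fun z hz => by
    have h := norm_add_le (a : ℂ) (z - a)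
    rw [add_sub_cancel] at h
    linarith
  -- The inf-sup bound needs only r²/4; the smaller 1/48 serves the contradiction at the centre.
  have hev1 := eventually_norm_quadForm_proj_sub_le hA hL e hH (η := r ^ 2 / 48) hM0 (by positivity)
  have hev2 : ∀ᶠ n in atTop, ‖(proj (hL n) (e n) (u : H) : H) - u‖ < ‖(u : H)‖ / 2 := by
    have h := hH 0 0 u (mem_eigenspace_iff.mp hu)
    filter_upwards [h.eventually (gt_mem_nhds (half_pos hu0'))] with n hn
    rwa [← defect_zero_zero (hL n) (e n) (a : ℂ) (u : H)]
  obtain ⟨N, hN⟩ := eventually_atTop.mp (hev1.and hev2)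
  refine ⟨N + 1, N.succ_pos, fun _ => r ^ 2 / 24 / (1 + 2 * M + M ^ 2), fun _ => by positivity, ?_⟩
  intro n hn B hB
  obtain ⟨herr, hproj⟩ := hN n (by omega)
  set C := coeffMatrix A (hL n) (e n) with hC
  have hpert : ∀ z : ℂ, ‖z - a‖ ≤ d / 4 → ∀ x, ‖pencil B z x - pencil C z x‖ ≤
      r ^ 2 / 24 * ‖x‖ := fun z hz x => by
    have h := norm_pencil_sub_le (fun p => (hB p).le) (hzM z hz)
    rw [div_mul_cancel₀ _ (by positivity)] at h
    rw [← sub_apply]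
    exact (ContinuousLinearMap.le_opNorm _ _).trans (by gcongr)
  have hCbound : ∀ z : ℂ, r ≤ ‖z - a‖ → ‖z - a‖ ≤ d / 4 → ∀ x,
      r ^ 2 / 6 * ‖x‖ ≤ ‖pencil C z x‖ := by
    intro z hz1 hz2 x
    obtain ⟨w, hwL, hw, hform⟩ := exists_mul_norm_sq_le_norm_quadForm hA hr0 (by linarith)
      (by nlinarith) hgap (hL n) (e n) hz1 hz2 (herr z (hzM z hz2)) (coordVec_mem (hL n) (e n) x)
    obtain ⟨y, rfl⟩ := exists_coordVec_eq (hL n) (e n) hwL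
    rw [← inner_pencil_coeffMatrix, norm_coordVec] at hform
    rw [norm_coordVec, norm_coordVec] at hw
    rcases (norm_nonneg x).eq_or_lt with h0 | h0
    · rw [← h0, mul_zero]; exact norm_nonneg _
    · have h1 : r ^ 2 / 2 * ‖x‖ ^ 2 ≤ 3 * ‖x‖ * ‖pencil C z x‖ :=
        hform.trans ((norm_inner_le_norm _ _).trans (by gcongr))
      refine le_of_mul_le_mul_left ?_ h0
      linarith
  have hBbound : ∀ z : ℂ, r ≤ ‖z - a‖ → ‖z - a‖ ≤ d / 4 → ∀ x,
      r ^ 2 / 8 * ‖x‖ ≤ ‖pencil B z x‖ := fun z hz1 hz2 x => by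
    have h1 := hCbound z hz1 hz2 x
    have h2 := hpert z hz2 x
    have h3 := norm_sub_norm_le (pencil C z x) (pencil B z x)
    rw [norm_sub_rev] at h3
    linarith
  have hκ : 0 < r ^ 2 / 8 := by positivity
  constructor
  · by_contra! hroot
    have hunit : ∀ z ∈ Metric.closedBall (a : ℂ) r, IsUnit (pencil B z) := fun z hz => by
      rw [isUnit_pencil_iff]
      intro hz'
      rw [mem_closedBall_iff_norm] at hz
      linarith [hroot z hz']
    obtain ⟨x, hx⟩ := exists_coordVec_eq (hL n) (e n) (proj_mem (hL n) (e n) (u : H))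
    have hcentre := mul_norm_le_of_sphere (differentiable_pencil B) hr0 hκ hunit
      (fun z hz y => by
        rw [mem_sphere_iff_norm] at hz
        exact hBbound z hz.ge (by linarith) y) x
    have ha0 : ‖(a : ℂ) - a‖ ≤ d / 4 := by rw [sub_self, norm_zero]; linarith
    have hxn : ‖(u : H)‖ / 2 < ‖x‖ := by
      rw [← norm_coordVec (hL n) (e n), hx]
      have h := norm_sub_norm_le (u : H) (proj (hL n) (e n) (u : H) : H)
      rw [norm_sub_rev] at h
      linarith
    -- At z = a the main term (z - a)²⟨v, u⟩ disappears. Since a is real, conjugation swaps the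
    -- slots and the error bound applies with the pencil's own value as test vector.
    have hsmall : ‖pencil C a x‖ ≤ r ^ 2 / 48 * ‖(u : H)‖ := by
      set y := pencil C a x with hy
      have h1 : inner ℂ y y = quadForm A a (coordVec (hL n) (e n) x) (coordVec (hL n) (e n) y) := by
        rw [← inner_pencil_coeffMatrix]
      have h2 := herr a (hzM a ha0) _ (coordVec_mem (hL n) (e n) y) u hu
      rw [sub_self, zero_pow two_ne_zero, zero_mul, sub_zero, norm_coordVec, ← Complex.norm_conj,
        conj_quadForm A hA, Complex.conj_ofReal, ← hx, ← h1, inner_self_eq_norm_sq_to_K,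
        norm_pow, RCLike.norm_ofReal, abs_norm, sq] at h2
      rcases (norm_nonneg y).eq_or_lt with h0 | h0
      · rw [← h0]; positivity
      · exact le_of_mul_le_mul_right h2 h0
    have h1 := hpert a ha0 x
    have h2 := norm_sub_norm_le (pencil B a x) (pencil C a x)
    -- With the perturbation, the value at the centre is below (1/24 + 1/24) r²‖x‖, less than the
    -- r²‖x‖/8 forced by the circle.
    have h3 : r ^ 2 / 48 * ‖(u : H)‖ < r ^ 2 / 24 * ‖x‖ := by
      have := mul_lt_mul_of_pos_left hxn (by positivity : 0 < r ^ 2 / 24)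
      linarith
    have h4 : 0 ≤ r ^ 2 * ‖x‖ := by positivity
    linarith
  · rw [Set.disjoint_left]
    rintro z hz ⟨hz1, hz2⟩
    obtain ⟨x, hx0, hx⟩ := Matrix.exists_mulVec_eq_zero_iff.mpr hz
    have h := hBbound z (by linarith) hz2 (WithLp.toLp 2 x)
    rw [pencil, Matrix.toEuclideanCLM_toLp, hx, WithLp.toLp_zero, norm_zero] at h
    have h2 : ‖WithLp.toLp 2 x‖ ≤ 0 := nonpos_of_mul_nonpos_right h hκ
    exact hx0 (by simpa using h2)
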